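/- **Theorem (Lorentzian $\mathcal Q(S)$ problem).** Let $\mathbb L^3$ be $\mathbb R^3$ with $\langle u,v\rangle=u_1v_1+u_2v_2-u_3v_3$. Let $\gamma:I\to\mathbb L^3$ be a smooth curve on an open interval $I\subseteq\mathbb R$ with $|\langle\gamma',\gamma'\rangle|\equiv1$, and put $\varepsilon_T=\langle\gamma',\gamma'\rangle\in\{-1,1\}$. For $r>0$ and $\varepsilon\in\{-1,1\}$ consider the points $\gamma(s)+v$, where $s\in I$, $\langle v,\gamma'(s)\rangle=0$ and $\langle v,v\rangle=\varepsilon r^2$. A *tubular surface* $S$ of radius $r$ and signal $\varepsilon$ around $\gamma$ is the (immersed) set of all these points $(s,v)$, assumed nonempty, or, when the normal sections have two branches, one of its two connected components. It is *regular* if $$\xi(s,v)=1-\varepsilon_T\langle v,\gamma''(s)\rangle\neq0\quad\text{at all its points}$$ (if $\gamma$ has a Frenet frame $T,N,B$ and $v=r\mu N+r\eta B$, this says $1+\varepsilon_B r\kappa\mu\ne0$, with $\varepsilon_B=\langle B,B\rangle$). A regular tubular surface is automatically nondegenerate. It is a *right cylinder* if $\gamma$ is a geodesic of $\mathbb L^3$,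 that is, $\gamma''\equiv0$. Orient $S$ by the unit normal $\mathcal N=-v/r$, which points towards the central curve; thus $\langle\mathcal N,\mathcal N\rangle=\varepsilon$. In a local parametrization $\psi$ of $S$, with $E,F,G$ the coefficients $\langle\psi_s,\psi_s\rangle,\langle\psi_s,\psi_t\rangle,\langle\psi_t,\psi_t\rangle$ and $e,f,g$ the coefficients $\langle\psi_{ss},\mathcal N\rangle,\langle\psi_{st},\mathcal N\rangle,\langle\psi_{tt},\mathcal N\rangle$, let $$K=\varepsilon\,\frac{eg-f^2}{EG-F^2},\qquad H=\varepsilon\,\frac{eG-2fF+gE}{2(EG-F^2)}.$$ Let $S$ be a regular tubular surface of radius $r$ and signal $\varepsilon$, and let $\mathcal Q_L(S)$ be the set of all polynomials $Q\in\mathbb R[x,y]$ such that $Q(K,H)=0$ at every point of $S$. 1. If $S$ is a right cylinder, then $\mathcal Q_L(S)=\{Q\in\mathbb R[x,y] : Q(0,\tfrac{\varepsilon}{2r})=0\}$. 2. If $S$ is not a right cylinder, then $\mathcal Q_L(S)$ is the ideal of $\mathbb R[x,y]$ generated by $xr^2-2ry+\varepsilon$. -/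

import Mathlib

open scoped ContDiff

noncomputable section

/-- The underlying vector space of the Lorentzian 3-space. -/
abbrev LSpace : Type := Fin 3 → ℝ

/-- The Lorentzian bilinear form `u₁v₁ + u₂v₂ - u₃v₃`. -/
def lorentz (u v : LSpace) : ℝ := u 0 * v 0 + u 1 * v 1 - u 2 * v 2

/-- The partial derivatives of a map of two real variables `(s, t)`. -/
def partialS (ψ : ℝ × ℝ → LSpace) (q : ℝ × ℝ) : LSpace := fderiv ℝ ψ q (1, 0)

def partialT (ψ : ℝ × ℝ → LSpace) (q : ℝ × ℝ) : LSpace := fderiv ℝ ψ q (0, 1)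

/-- Gaussian curvature, with respect to the unit normal field `n`, of the parametrized
surface `ψ`: `ε (eg - f²) / (EG - F²)` with `ε = ⟨n, n⟩`. -/
def gaussCurvature (ψ n : ℝ × ℝ → LSpace) (q : ℝ × ℝ) : ℝ :=
  let E := lorentz (partialS ψ q) (partialS ψ q)
  let F := lorentz (partialS ψ q) (partialT ψ q)
  let G := lorentz (partialT ψ q) (partialT ψ q)
  let e := lorentz (partialS (partialS ψ) q) (n q)
  let f := lorentz (partialT (partialS ψ) q) (n q)
  let g := lorentz (partialT (partialT ψ) q) (n q)
  lorentz (n q) (n q) * ((e * g - f ^ 2) / (E * G - F ^ 2))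

/-- Mean curvature, with respect to the unit normal field `n`, of the parametrized
surface `ψ`: `ε (eG - 2fF + gE) / (2(EG - F²))` with `ε = ⟨n, n⟩`. -/
def meanCurvature (ψ n : ℝ × ℝ → LSpace) (q : ℝ × ℝ) : ℝ :=
  let E := lorentz (partialS ψ q) (partialS ψ q)
  let F := lorentz (partialS ψ q) (partialT ψ q)
  let G := lorentz (partialT ψ q) (partialT ψ q)
  let e := lorentz (partialS (partialS ψ) q) (n q)
  let f := lorentz (partialT (partialS ψ) q) (n q)
  let g := lorentz (partialT (partialT ψ) q) (n q)
  lorentz (n q) (n q) * ((e * G - 2 * f * F + g * E) / (2 * (E * G - F ^ 2)))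

/-- The pairs `(s, v)` for which `γ s + v` lies on the normal section at `γ s`: `v` is orthogonal
to `γ' s` and `⟨v, v⟩ = ε r²`. The sections are Lorentzian circles for `ε = 1` and
Lorentzian hyperbolas for `ε = -1`. -/
def normalSections (I : Set ℝ) (γ : ℝ → LSpace) (r ε : ℝ) : Set (ℝ × LSpace) :=
  {p | p.1 ∈ I ∧ lorentz p.2 (deriv γ p.1) = 0 ∧ lorentz p.2 p.2 = ε * r ^ 2}

/-- A tubular surface of radius `r` and signal `ε` in the Lorentzian 3-space. Its points are recorded
as pairs `(s, v)`, standing for the point `γ s + v` of the normal section at `γ s`.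

If `γ` is spacelike, each normal section has two branches (the two signs `±` in front of `cosh`
in the usual parametrizations). The surface may consist of all the sections or of one branch:
its set of points is a nonempty open and closed part of the set of all `(s, v)`. For a timelike `γ`
and `ε = 1` the sections are connected and the surface is the whole tube; for a timelike `γ` and
`ε = -1` there are no points at all, hence no such surface. -/
structure TubularSurface where
  /-- the open interval on which the central curve is defined -/
  I : Set ℝ
  isOpen_I : IsOpen I
  ordConnected_I : I.OrdConnected
  /-- the central curve: smooth and parametrized by arc length -/
  γ : ℝ → LSpace
  smooth_γ : ContDiffOn ℝ ∞ γ I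
  arcLength_γ : ∀ s ∈ I, |lorentz (deriv γ s) (deriv γ s)| = 1
  /-- the radius -/
  r : ℝ
  r_pos : 0 < r
  /-- the signal -/
  ε : ℝ
  signal_eq : ε = 1 ∨ ε = -1
  /-- the points of the surface -/
  carrier : Set (ℝ × LSpace)
  carrier_subset : carrier ⊆ normalSections I γ r ε
  carrier_nonempty : carrier.Nonempty
  carrier_isClopen : IsClopen ((↑) ⁻¹' carrier : Set (normalSections I γ r ε))

namespace TubularSurface

/-- The regularity function `ξ = 1 - ε_T ⟨v, γ''⟩`, where `ε_T = ⟨γ', γ'⟩`. In a Frenet frame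
it is `1 + ε_B r κ μ` (see `xi_eq_frenet`). -/
def xi (S : TubularSurface) (p : ℝ × LSpace) : ℝ :=
  1 - lorentz (deriv S.γ p.1) (deriv S.γ p.1) * lorentz p.2 (deriv (deriv S.γ) p.1)

/-- If `γ'' = κ N` with `N, B` orthogonal, `⟨B, B⟩ = -⟨γ', γ'⟩⟨N, N⟩` and `v = r μ N + r η B`,
then `ξ = 1 + ⟨B, B⟩ r κ μ`. -/
theorem xi_eq_frenet (S : TubularSurface) (s κ μ η : ℝ) (N B : LSpace)
    (hN : deriv (deriv S.γ) s = κ • N) (hNB : lorentz N B = 0)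
    (hB : lorentz B B = -(lorentz (deriv S.γ s) (deriv S.γ s) * lorentz N N)) :
    S.xi (s, (S.r * μ) • N + (S.r * η) • B) = 1 + lorentz B B * S.r * κ * μ := by
  have h : lorentz ((S.r * μ) • N + (S.r * η) • B) (κ • N)
      = S.r * μ * κ * lorentz N N + S.r * η * κ * lorentz N B := by
    simp only [lorentz, Pi.add_apply, Pi.smul_apply, smul_eq_mul]; ring
  simp only [xi, hN, h, hNB, hB]; ring

/-- The surface is regular: `ξ` has no zero on it. -/
def IsRegular (S : TubularSurface) : Prop := ∀ p ∈ S.carrier, S.xi p ≠ 0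

/-- The surface is a right cylinder: its central curve is a geodesic of the ambient space. -/
def IsRightCylinder (S : TubularSurface) : Prop := ∀ s ∈ S.I, deriv (deriv S.γ) s = 0

/-- `(σ, v)`, defined on the open set `U`, gives the local parametrization `γ ∘ σ + v` of the surface:
it is smooth, takes its values in the surface, and is an immersion. -/
structure IsLocalParam (S : TubularSurface) (U : Set (ℝ × ℝ)) (σ : ℝ × ℝ → ℝ)
    (v : ℝ × ℝ → LSpace) : Prop where
  isOpen : IsOpen U
  smooth_σ : ContDiffOn ℝ ∞ σ U
  smooth_v : ContDiffOn ℝ ∞ v U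
  mem : ∀ q ∈ U, (σ q, v q) ∈ S.carrier
  immersion : ∀ q ∈ U, Function.Injective (fderiv ℝ (fun q => S.γ (σ q) + v q) q)

/-- The set of the polynomials `Q(x, y)` with `Q(K, H) = 0` at every point of the surface, the curvatures
being computed in local parametrizations with the unit normal field `-v / r`, which points from
`γ s + v` towards `γ s` (that is `-μ N - η B` for `v = r μ N + r η B`). -/
def polynomialRelations (S : TubularSurface) : Set (MvPolynomial (Fin 2) ℝ) :=
  {Q | ∀ (U : Set (ℝ × ℝ)) (σ : ℝ × ℝ → ℝ) (v : ℝ × ℝ → LSpace), S.IsLocalParam U σ v →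
    ∀ q ∈ U, MvPolynomial.eval
      ![gaussCurvature (fun q => S.γ (σ q) + v q) (fun q => -(S.r⁻¹ • v q)) q,
        meanCurvature (fun q => S.γ (σ q) + v q) (fun q => -(S.r⁻¹ • v q)) q] Q = 0}

end TubularSurface

/-- The Lorentzian `ε`-radius of a polynomial `Q(x, y)`. -/
def lorentzRadius (ε : ℝ) (Q : MvPolynomial (Fin 2) ℝ) : Set ℝ :=
  {r | 0 < r ∧ MvPolynomial.eval ![0, ε / (2 * r)] Q = 0}

end

/-! Write `ψ = γ ∘ σ + v`, `T = γ' ∘ σ`, `η = ⟨T, T⟩` and `n = -v / r`. Since `dv = dψ - dσ T` and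
`⟨T, dψ⟩ = η ξ dσ`, the second fundamental form is `(I - η ξ dσ²) / r`, with `I` the induced metric.
Its trace and determinant relative to `I` give `K = ε (1 - ξ⁻¹) / r²` and `H = ε (2 - ξ⁻¹) / (2r)`
in every local parametrization (`curvatures`). Hence `(K, H)` always lies on the line `x r² - 2 r y
+ ε = 0`.

On a right cylinder `ξ = 1`, and only the point `(0, ε / (2r))` occurs. Otherwise choose `s` with
`γ'' s ≠ 0`: on the normal section there, `⟨v, γ''⟩` is a nonzero linear form restricted to a conic,
so `ξ`, and with it `K`, takes infinitely many values (`infinite_gaussCurvature`). A polynomial with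
infinitely many zeros on the line is a multiple of its equation (`mem_span_of_infinite`).

Both cases need actual local parametrizations (`exists_isLocalParam`). Reflections carry the normal
plane at `s₀` to the nearby ones, so no Frenet frame is needed, and one rational formula covers
circles and hyperbolas. -/

lemma lorentz_comm (u v : LSpace) : lorentz u v = lorentz v u := by
  simp only [lorentz]; ring

lemma lorentz_add_left (u v w : LSpace) : lorentz (u + v) w = lorentz u w + lorentz v w := by
  simp only [lorentz, Pi.add_apply]; ring

lemma lorentz_add_right (u v w : LSpace) : lorentz u (v + w) = lorentz u v + lorentz u w := by
  simp only [lorentz, Pi.add_apply]; ring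

lemma lorentz_sub_right (u v w : LSpace) : lorentz u (v - w) = lorentz u v - lorentz u w := by
  simp only [lorentz, Pi.sub_apply]; ring

lemma lorentz_smul_left (c : ℝ) (u v : LSpace) : lorentz (c • u) v = c * lorentz u v := by
  simp only [lorentz, Pi.smul_apply, smul_eq_mul]; ring

lemma lorentz_smul_right (c : ℝ) (u v : LSpace) : lorentz u (c • v) = c * lorentz u v := by
  simp only [lorentz, Pi.smul_apply, smul_eq_mul]; ring

lemma lorentz_neg_left (u v : LSpace) : lorentz (-u) v = -lorentz u v := by
  simp only [lorentz, Pi.neg_apply]; ring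

lemma lorentz_neg_right (u v : LSpace) : lorentz u (-v) = -lorentz u v := by
  simp only [lorentz, Pi.neg_apply]; ring

lemma lorentz_zero_left (v : LSpace) : lorentz 0 v = 0 := by
  simp [lorentz]

lemma contDiffOn_lorentz {E : Type*} [NormedAddCommGroup E] [NormedSpace ℝ E]
    {f g : E → LSpace} {s : Set E} {n : WithTop ℕ∞} (hf : ContDiffOn ℝ n f s)
    (hg : ContDiffOn ℝ n g s) : ContDiffOn ℝ n (fun x => lorentz (f x) (g x)) s := by
  rw [contDiffOn_pi] at hf hg
  exact (((hf 0).mul (hg 0)).add ((hf 1).mul (hg 1))).sub ((hf 2).mul (hg 2))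

/-- The derivative of a constant Lorentzian product. -/
lemma lorentz_fderiv_add_of_eventually_const {E : Type*} [NormedAddCommGroup E] [NormedSpace ℝ E]
    {f g : E → LSpace} {q : E} {c : ℝ} (hf : DifferentiableAt ℝ f q)
    (hg : DifferentiableAt ℝ g q) (h : ∀ᶠ y in nhds q, lorentz (f y) (g y) = c) (x : E) :
    lorentz (fderiv ℝ f q x) (g q) + lorentz (f q) (fderiv ℝ g q x) = 0 := by
  have hf' := hasFDerivAt_pi'.1 hf.hasFDerivAt
  have hg' := hasFDerivAt_pi'.1 hg.hasFDerivAt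
  have hd := (((hf' 0).mul (hg' 0)).add ((hf' 1).mul (hg' 1))).sub ((hf' 2).mul (hg' 2))
  have hc : HasFDerivAt (fun y => lorentz (f y) (g y)) (0 : E →L[ℝ] ℝ) q :=
    (hasFDerivAt_const c q).congr_of_eventuallyEq h
  have := congrArg (fun L : E →L[ℝ] ℝ => L x) (hd.unique hc)
  simp at this
  simp only [lorentz]
  linarith

/-! ### Gram determinants and the algebra of the curvature quotients. -/

/-- The determinant of three vectors. -/
def triple (a b c : LSpace) : ℝ :=
  a 0 * (b 1 * c 2 - b 2 * c 1) - a 1 * (b 0 * c 2 - b 2 * c 0) + a 2 * (b 0 * c 1 - b 1 * c 0)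

/-- The Gram matrix is `M J Mᵀ` with `J = diag(1, 1, -1)`; the sign is `det J`. -/
lemma gram_eq_neg_triple_sq (a b c : LSpace) :
    lorentz a a * (lorentz b b * lorentz c c - lorentz b c ^ 2)
      - lorentz a b * (lorentz a b * lorentz c c - lorentz b c * lorentz a c)
      + lorentz a c * (lorentz a b * lorentz b c - lorentz b b * lorentz a c)
      = -triple a b c ^ 2 := by
  simp only [lorentz, triple]; ring

lemma triple_eq_zero_of_orthogonal {a b c v : LSpace} (hv : v ≠ 0) (ha : lorentz a v = 0)
    (hb : lorentz b v = 0) (hc : lorentz c v = 0) : triple a b c = 0 := by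
  by_contra h
  apply hv
  simp only [lorentz] at ha hb hc
  ext i
  apply (mul_eq_zero.1 (_ : triple a b c * v i = 0)).resolve_left h
  fin_cases i <;> simp only [triple] <;> dsimp
  · linear_combination (b 1 * c 2 - b 2 * c 1) * ha - (a 1 * c 2 - a 2 * c 1) * hb
      + (a 1 * b 2 - a 2 * b 1) * hc
  · linear_combination -(b 0 * c 2 - b 2 * c 0) * ha + (a 0 * c 2 - a 2 * c 0) * hb
      - (a 0 * b 2 - a 2 * b 0) * hc
  · linear_combination -(b 0 * c 1 - b 1 * c 0) * ha + (a 0 * c 1 - a 1 * c 0) * hb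
      - (a 0 * b 1 - a 1 * b 0) * hc

lemma exists_combination_of_triple_eq_zero {a b c : LSpace} (h : triple a b c = 0) :
    ∃ x y z : ℝ, (x ≠ 0 ∨ y ≠ 0 ∨ z ≠ 0) ∧ x • a + y • b + z • c = 0 := by
  have hdet : (Matrix.of ![a, b, c] : Matrix (Fin 3) (Fin 3) ℝ).det = 0 := by
    rw [Matrix.det_fin_three, ← h]; simp [triple]; ring
  obtain ⟨w, hw, h0⟩ := Matrix.exists_vecMul_eq_zero_iff.2 hdet
  refine ⟨w 0, w 1, w 2, ?_, ?_⟩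
  · by_contra! hn
    apply hw
    ext i
    fin_cases i <;> simp [hn.1, hn.2.1, hn.2.2]
  · rw [← h0]
    ext i
    simp [Matrix.vecMul, dotProduct, Fin.sum_univ_three]

/-- The induced metric in terms of its restriction to the normal sections. -/
lemma gram_of_tangent {T v A B : LSpace} {η x p q : ℝ} (hv : v ≠ 0) (hη : η ≠ 0)
    (hTT : lorentz T T = η) (hTv : lorentz T v = 0) (hAv : lorentz A v = 0)
    (hBv : lorentz B v = 0) (hTA : lorentz T A = η * x * p) (hTB : lorentz T B = η * x * q) :
    lorentz A A * lorentz B B - lorentz A B ^ 2 = η * x ^ 2 *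
      (lorentz A A * q ^ 2 - 2 * lorentz A B * p * q + lorentz B B * p ^ 2) := by
  -- All three vectors lie in the plane orthogonal to `v`, so their Gram determinant vanishes.
  have h := gram_eq_neg_triple_sq T A B
  rw [triple_eq_zero_of_orthogonal hv hTv hAv hBv, hTT, hTA, hTB] at h
  apply mul_left_cancel₀ hη
  linear_combination h

/-- This is the nondegeneracy of the surface: adjoining the nonisotropic normal `v` to two
independent tangent vectors gives a basis, whose Gram determinant cannot vanish. -/
lemma gram_ne_zero_of_orthogonal {A B v : LSpace} (hv : lorentz v v ≠ 0) (hAv : lorentz A v = 0)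
    (hBv : lorentz B v = 0) (hAB : ∀ x y : ℝ, x • A + y • B = 0 → x = 0 ∧ y = 0) :
    lorentz A A * lorentz B B - lorentz A B ^ 2 ≠ 0 := by
  intro h
  have h3 := gram_eq_neg_triple_sq A B v
  rw [hAv, hBv] at h3
  have h4 : triple A B v = 0 := by
    apply pow_eq_zero_iff (two_ne_zero) |>.1
    linear_combination h3 - lorentz v v * h
  obtain ⟨x, y, z, hne, h0⟩ := exists_combination_of_triple_eq_zero h4
  have hz : z = 0 := by
    have := congrArg (fun w => lorentz w v) h0
    simp only [lorentz_add_left, lorentz_smul_left, hAv, hBv, lorentz_zero_left] at this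
    have : z * lorentz v v = 0 := by linarith
    exact (mul_eq_zero.1 this).resolve_right hv
  subst hz
  obtain ⟨rfl, rfl⟩ := hAB x y (by simpa using h0)
  simp at hne

/-- The curvature quotients when the second fundamental form is `(I - η x dσ²) / r`. -/
lemma curvature_quotients {E F G η x p q r ε : ℝ} (hx : x ≠ 0) (hr : r ≠ 0)
    (hW : E * G - F ^ 2 ≠ 0)
    (h : E * G - F ^ 2 = η * x ^ 2 * (E * q ^ 2 - 2 * F * p * q + G * p ^ 2)) :
    ε * ((r⁻¹ * (E - η * x * p * p) * (r⁻¹ * (G - η * x * q * q))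
        - (r⁻¹ * (F - η * x * p * q)) ^ 2) / (E * G - F ^ 2)) = ε * (1 - x⁻¹) / r ^ 2 ∧
    ε * ((r⁻¹ * (E - η * x * p * p) * G - 2 * (r⁻¹ * (F - η * x * p * q)) * F
        + r⁻¹ * (G - η * x * q * q) * E) / (2 * (E * G - F ^ 2)))
      = ε * (2 - x⁻¹) / (2 * r) := by
  -- This is the correction that the rank-one term `η x dσ²` brings to both the determinant and the
  -- trace.
  have hP : η * x * (E * q ^ 2 - 2 * F * p * q + G * p ^ 2) = x⁻¹ * (E * G - F ^ 2) := by
    rw [h]; field_simp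
  constructor
  · have : r⁻¹ * (E - η * x * p * p) * (r⁻¹ * (G - η * x * q * q))
        - (r⁻¹ * (F - η * x * p * q)) ^ 2 = (1 - x⁻¹) / r ^ 2 * (E * G - F ^ 2) := by
      field_simp at hP ⊢
      linear_combination (-1 : ℝ) * hP
    rw [this, mul_div_cancel_right₀ _ hW, mul_div_assoc]
  · have : r⁻¹ * (E - η * x * p * p) * G - 2 * (r⁻¹ * (F - η * x * p * q)) * F
        + r⁻¹ * (G - η * x * q * q) * E = (2 - x⁻¹) / (2 * r) * (2 * (E * G - F ^ 2)) := by
      field_simp at hP ⊢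
      linear_combination (-1 : ℝ) * hP
    rw [this, mul_div_cancel_right₀ _ (mul_ne_zero two_ne_zero hW), mul_div_assoc]

/-! ### Curvatures in an arbitrary local parametrization. -/

namespace TubularSurface

variable (S : TubularSurface)

lemma contDiffOn_deriv : ContDiffOn ℝ ∞ (deriv S.γ) S.I :=
  S.smooth_γ.deriv_of_isOpen S.isOpen_I (by simp)

lemma tangent_sq {s : ℝ} (hs : s ∈ S.I) : lorentz (deriv S.γ s) (deriv S.γ s) ^ 2 = 1 := by
  rw [← sq_abs, S.arcLength_γ s hs, one_pow]

lemma tangent_const {s t : ℝ} (hs : s ∈ S.I) (ht : t ∈ S.I) :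
    lorentz (deriv S.γ s) (deriv S.γ s) = lorentz (deriv S.γ t) (deriv S.γ t) := by
  have hc : ContinuousOn (fun s => lorentz (deriv S.γ s) (deriv S.γ s)) S.I :=
    (contDiffOn_lorentz S.contDiffOn_deriv S.contDiffOn_deriv).continuousOn
  have h := S.ordConnected_I.isPreconnected.eq_one_or_eq_neg_one_of_sq_eq hc
    (fun s hs => by simpa using S.tangent_sq hs)
  rcases h with h | h
  · exact (h hs).trans (h ht).symm
  · exact (h hs).trans (h ht).symm

lemma signal_ne_zero : S.ε ≠ 0 := by
  rcases S.signal_eq with h | h <;> rw [h] <;> norm_num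

lemma differentiableAt_curve {s : ℝ} (hs : s ∈ S.I) : DifferentiableAt ℝ S.γ s :=
  (S.smooth_γ.contDiffAt (S.isOpen_I.mem_nhds hs)).differentiableAt (by simp)

lemma differentiableAt_tangent {s : ℝ} (hs : s ∈ S.I) : DifferentiableAt ℝ (deriv S.γ) s :=
  (S.contDiffOn_deriv.contDiffAt (S.isOpen_I.mem_nhds hs)).differentiableAt (by simp)

lemma fderiv_tube {σ : ℝ × ℝ → ℝ} {v : ℝ × ℝ → LSpace} {q : ℝ × ℝ} (hI : σ q ∈ S.I)
    (hσ : DifferentiableAt ℝ σ q) (hv : DifferentiableAt ℝ v q) (x : ℝ × ℝ) :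
    fderiv ℝ (fun q => S.γ (σ q) + v q) q x
      = fderiv ℝ σ q x • deriv S.γ (σ q) + fderiv ℝ v q x := by
  have h1 := ((S.differentiableAt_curve hI).hasDerivAt.hasFDerivAt.comp q hσ.hasFDerivAt).add
    hv.hasFDerivAt
  have h2 : fderiv ℝ (fun q => S.γ (σ q) + v q) q = _ := h1.fderiv
  rw [h2]; simp

/-- The component of the derivative of a tube along the central curve. -/
lemma lorentz_tangent_fderiv_tube {σ : ℝ × ℝ → ℝ} {v : ℝ × ℝ → LSpace} {q : ℝ × ℝ}
    (hI : σ q ∈ S.I) (hσ : DifferentiableAt ℝ σ q) (hv : DifferentiableAt ℝ v q)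
    (h : ∀ᶠ y in nhds q, lorentz (v y) (deriv S.γ (σ y)) = 0) (y : ℝ × ℝ) :
    lorentz (deriv S.γ (σ q)) (fderiv ℝ (fun q => S.γ (σ q) + v q) q y)
      = lorentz (deriv S.γ (σ q)) (deriv S.γ (σ q)) * S.xi (σ q, v q) * fderiv ℝ σ q y := by
  have h1 := (S.differentiableAt_tangent hI).hasDerivAt.hasFDerivAt.comp q hσ.hasFDerivAt
  have h2 := lorentz_fderiv_add_of_eventually_const hv h1.differentiableAt h y
  rw [h1.fderiv] at h2
  simp [lorentz_smul_right] at h2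
  rw [S.fderiv_tube hI hσ hv, lorentz_add_right, lorentz_smul_right,
    lorentz_comm _ (fderiv ℝ v q y)]
  simp only [xi]
  -- `h2` turns `⟨T, dv⟩` into `-⟨v, γ''⟩ dσ`; `η² = 1` then allows `η` to be factored out, leaving
  -- `ξ`.
  linear_combination h2 + fderiv ℝ σ q y * lorentz (v q) (deriv (deriv S.γ) (σ q))
    * S.tangent_sq hI

/-- The curvatures of a regular tubular surface. -/
theorem curvatures (hS : S.IsRegular) {U : Set (ℝ × ℝ)} {σ : ℝ × ℝ → ℝ} {v : ℝ × ℝ → LSpace}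
    (h : S.IsLocalParam U σ v) {q : ℝ × ℝ} (hq : q ∈ U) :
    gaussCurvature (fun q => S.γ (σ q) + v q) (fun q => -(S.r⁻¹ • v q)) q
        = S.ε * (1 - (S.xi (σ q, v q))⁻¹) / S.r ^ 2 ∧
    meanCurvature (fun q => S.γ (σ q) + v q) (fun q => -(S.r⁻¹ • v q)) q
        = S.ε * (2 - (S.xi (σ q, v q))⁻¹) / (2 * S.r) := by
  set ψ : ℝ × ℝ → LSpace := fun q => S.γ (σ q) + v q with hψ
  have hr := S.r_pos.ne'
  have hsec : ∀ y ∈ U, σ y ∈ S.I ∧ lorentz (v y) (deriv S.γ (σ y)) = 0 ∧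
      lorentz (v y) (v y) = S.ε * S.r ^ 2 := fun y hy => S.carrier_subset (h.mem y hy)
  have hUn : ∀ y ∈ U, U ∈ nhds y := fun y hy => h.isOpen.mem_nhds hy
  have hdσ : ∀ y ∈ U, DifferentiableAt ℝ σ y := fun y hy =>
    (h.smooth_σ.contDiffAt (hUn y hy)).differentiableAt (by simp)
  have hdv : ∀ y ∈ U, DifferentiableAt ℝ v y := fun y hy =>
    (h.smooth_v.contDiffAt (hUn y hy)).differentiableAt (by simp)
  have hψs : ContDiffOn ℝ ∞ ψ U :=
    (S.smooth_γ.comp h.smooth_σ (fun y hy => (hsec y hy).1)).add h.smooth_v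
  have hψ' : ∀ y ∈ U, ∀ x, fderiv ℝ ψ y x
      = fderiv ℝ σ y x • deriv S.γ (σ y) + fderiv ℝ v y x := fun y hy =>
    S.fderiv_tube (hsec y hy).1 (hdσ y hy) (hdv y hy)
  have hvv : ∀ y ∈ U, ∀ x, lorentz (fderiv ℝ v y x) (v y) = 0 := by
    intro y hy x
    have := lorentz_fderiv_add_of_eventually_const (hdv y hy) (hdv y hy)
      (Filter.eventually_of_mem (hUn y hy) fun z hz => (hsec z hz).2.2) x
    rw [lorentz_comm (v y)] at this
    linarith
  have hψv : ∀ y ∈ U, ∀ x, lorentz (fderiv ℝ ψ y x) (v y) = 0 := by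
    intro y hy x
    rw [hψ' y hy, lorentz_add_left, lorentz_smul_left, lorentz_comm, (hsec y hy).2.1, hvv y hy]
    ring
  set T := deriv S.γ (σ q) with hT
  set η := lorentz T T with hη
  have hη2 : η ^ 2 = 1 := S.tangent_sq (hsec q hq).1
  set x := S.xi (σ q, v q) with hx
  have hψT : ∀ y, lorentz T (fderiv ℝ ψ q y) = η * x * fderiv ℝ σ q y :=
    S.lorentz_tangent_fderiv_tube (hsec q hq).1 (hdσ q hq) (hdv q hq)
      (Filter.eventually_of_mem (hUn q hq) fun z hz => (hsec z hz).2.1)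
  have hn : ∀ y, fderiv ℝ (fun q => -(S.r⁻¹ • v q)) q y = -(S.r⁻¹ • fderiv ℝ v q y) := by
    intro y
    exact congrArg (fun L : ℝ × ℝ →L[ℝ] LSpace => L y)
      (((hdv q hq).hasFDerivAt.const_smul S.r⁻¹).neg).fderiv
  -- Differentiate `⟨dψ(y), n⟩ = 0` in the direction `z`, using `dn = -(dψ - dσ T) / r`.
  have hII : ∀ y z, lorentz (fderiv ℝ (fun w => fderiv ℝ ψ w y) q z) (-(S.r⁻¹ • v q))
      = S.r⁻¹ * (lorentz (fderiv ℝ ψ q y) (fderiv ℝ ψ q z)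
        - η * x * fderiv ℝ σ q y * fderiv ℝ σ q z) := by
    intro y z
    have hd : DifferentiableAt ℝ (fun w => fderiv ℝ ψ w y) q :=
      (((hψs.fderiv_of_isOpen h.isOpen (m := ∞) (by simp)).contDiffAt
        (hUn q hq)).differentiableAt (by simp)).clm_apply (differentiableAt_const y)
    have h1 := lorentz_fderiv_add_of_eventually_const (c := 0) hd
      (((hdv q hq).const_smul S.r⁻¹).neg)
      (Filter.eventually_of_mem (hUn q hq) fun w hw => by
        simp [lorentz_neg_right, lorentz_smul_right, hψv w hw]) z
    have h2 : fderiv ℝ v q z = fderiv ℝ ψ q z - fderiv ℝ σ q z • T := by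
      rw [hψ' q hq]; simp [hT]
    have h3 := hn z
    rw [show (-(S.r⁻¹ • v)) = fun q => -(S.r⁻¹ • v q) from rfl, h3, h2] at h1
    simp only [lorentz_neg_right, lorentz_smul_right, lorentz_sub_right] at h1 ⊢
    rw [lorentz_comm _ T, hψT] at h1
    linear_combination h1
  have hvn : lorentz (v q) (v q) ≠ 0 := by
    rw [(hsec q hq).2.2]; exact mul_ne_zero S.signal_ne_zero (pow_ne_zero 2 hr)
  have hv0 : v q ≠ 0 := fun h0 => hvn (by rw [h0, lorentz_zero_left])
  have hη0 : η ≠ 0 := fun h0 => by rw [h0] at hη2; norm_num at hη2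
  have hW := gram_ne_zero_of_orthogonal hvn (hψv q hq (1, 0)) (hψv q hq (0, 1)) (by
    intro a b hab
    have h1 : fderiv ℝ ψ q (a, b) = fderiv ℝ ψ q 0 := by
      rw [map_zero, ← hab, ← map_smul, ← map_smul, ← map_add]; simp
    simpa using h.immersion q hq h1)
  have hgram := gram_of_tangent (T := T) hv0 hη0 rfl
    (by rw [lorentz_comm]; exact (hsec q hq).2.1)
    (hψv q hq (1, 0)) (hψv q hq (0, 1)) (hψT _) (hψT _)
  have hnn : lorentz (-(S.r⁻¹ • v q)) (-(S.r⁻¹ • v q)) = S.ε := by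
    simp only [lorentz_neg_right, lorentz_neg_left, lorentz_smul_right, lorentz_smul_left,
      (hsec q hq).2.2]
    field_simp
  have key := curvature_quotients (ε := S.ε) (hS _ (h.mem q hq)) hr hW hgram
  have e1 := hII (1, 0) (1, 0)
  have e2 := hII (1, 0) (0, 1)
  have e3 := hII (0, 1) (0, 1)
  constructor
  · rw [← key.1]
    simp only [gaussCurvature, partialS, partialT]
    erw [hnn, e1, e2, e3]
  · rw [← key.2]
    simp only [meanCurvature, partialS, partialT]
    erw [hnn, e1, e2, e3]

end TubularSurface

/-! ### Reflections, cross product, conics, and polynomials on a line. -/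

/-- The Lorentzian reflection in the plane orthogonal to `c`. -/
noncomputable def lorentzReflection (c x : LSpace) : LSpace :=
  x - (2 * lorentz x c / lorentz c c) • c

lemma lorentz_reflection_reflection {c : LSpace} (hc : lorentz c c ≠ 0) (x y : LSpace) :
    lorentz (lorentzReflection c x) (lorentzReflection c y) = lorentz x y := by
  simp only [lorentzReflection, sub_eq_add_neg, lorentz_add_left, lorentz_add_right,
    lorentz_neg_left, lorentz_neg_right, lorentz_smul_left, lorentz_smul_right, lorentz_comm c]
  field_simp
  ring

lemma lorentzReflection_involutive {c : LSpace} (hc : lorentz c c ≠ 0) (x : LSpace) :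
    lorentzReflection c (lorentzReflection c x) = x := by
  have h : lorentz (lorentzReflection c x) c = -lorentz x c := by
    simp only [lorentzReflection, sub_eq_add_neg, lorentz_add_left, lorentz_neg_left,
      lorentz_smul_left]
    field_simp
    ring
  rw [lorentzReflection, h, lorentzReflection]
  module

/-- The reflection in the plane orthogonal to `a + b` exchanges the normal planes of `a`, `b`. -/
lemma lorentz_reflection_add_eq_zero {a b x : LSpace} (hc : lorentz (a + b) (a + b) ≠ 0)
    (hab : lorentz a a = lorentz b b) (hx : lorentz x b = 0) :
    lorentz (lorentzReflection (a + b) x) a = 0 := by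
  have h : lorentz (a + b) (a + b) = 2 * lorentz (a + b) a := by
    simp only [lorentz_add_left, lorentz_add_right, hab, lorentz_comm b a]; ring
  have h' : lorentz (a + b) a ≠ 0 := fun h0 => hc (by rw [h, h0, mul_zero])
  rw [lorentzReflection, sub_eq_add_neg, lorentz_add_left, lorentz_neg_left, lorentz_smul_left, h,
    lorentz_add_right, hx]
  field_simp
  ring

lemma contDiffOn_lorentzReflection {E : Type*} [NormedAddCommGroup E] [NormedSpace ℝ E]
    {f : E → LSpace} {s : Set E} {n : WithTop ℕ∞} (hf : ContDiffOn ℝ n f s)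
    (h : ∀ y ∈ s, lorentz (f y) (f y) ≠ 0) (x : LSpace) :
    ContDiffOn ℝ n (fun y => lorentzReflection (f y) x) s :=
  contDiffOn_const.sub (((contDiffOn_const.mul (contDiffOn_lorentz contDiffOn_const hf)).div
    (contDiffOn_lorentz hf hf) h).smul hf)

/-- The cross product for the Lorentzian form. -/
def lorentzCross (a b : LSpace) : LSpace :=
  ![a 1 * b 2 - a 2 * b 1, a 2 * b 0 - a 0 * b 2, a 1 * b 0 - a 0 * b 1]

lemma lorentz_cross_left (a b : LSpace) : lorentz (lorentzCross a b) a = 0 := by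
  simp [lorentz, lorentzCross]; ring

lemma lorentz_cross_right (a b : LSpace) : lorentz (lorentzCross a b) b = 0 := by
  simp [lorentz, lorentzCross]; ring

/-- Lagrange's identity, with the sign opposite to the Euclidean one. For `a = γ'` and `b = v` it
makes `a × v` a conjugate vector for the conic through `v`, whether that is a circle or a hyperbola.
-/
lemma lorentz_cross_self (a b : LSpace) : lorentz (lorentzCross a b) (lorentzCross a b)
    = lorentz a b ^ 2 - lorentz a a * lorentz b b := by
  simp [lorentz, lorentzCross]; ring

/-- A vector orthogonal to `a`, `b` and `a × b` vanishes. -/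
lemma eq_zero_of_orthogonal_cross {a b k : LSpace} (ha : lorentz a a ≠ 0) (hb : lorentz b b ≠ 0)
    (hab : lorentz a b = 0) (hak : lorentz a k = 0) (hbk : lorentz b k = 0)
    (huk : lorentz (lorentzCross a b) k = 0) : k = 0 := by
  by_contra hk
  have h := gram_eq_neg_triple_sq a b (lorentzCross a b)
  rw [triple_eq_zero_of_orthogonal hk hak hbk huk, lorentz_cross_self, hab,
    lorentz_comm b (lorentzCross a b), lorentz_cross_right, lorentz_comm a (lorentzCross a b),
    lorentz_cross_left] at h
  have : (lorentz a a * lorentz b b) ^ 2 = 0 := by linear_combination (-1 : ℝ) * h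
  exact mul_ne_zero ha hb (pow_eq_zero_iff two_ne_zero |>.1 this)

/-- The rational parametrization of the conic through `V` with conjugate vector `W`. -/
noncomputable def conic (η : ℝ) (V W : LSpace) (t : ℝ) : LSpace :=
  ((1 + η * t ^ 2) / (1 - η * t ^ 2)) • V + (2 * t / (1 - η * t ^ 2)) • W

lemma conic_zero (η : ℝ) (V W : LSpace) : conic η V W 0 = V := by simp [conic]

lemma lorentz_conic_left (η t : ℝ) (V W k : LSpace) : lorentz (conic η V W t) k
    = (1 + η * t ^ 2) / (1 - η * t ^ 2) * lorentz V k + 2 * t / (1 - η * t ^ 2) * lorentz W k := by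
  rw [conic, lorentz_add_left, lorentz_smul_left, lorentz_smul_left]

lemma lorentz_conic_self {η t : ℝ} {V W : LSpace} (ht : 1 - η * t ^ 2 ≠ 0)
    (hVW : lorentz V W = 0) (hW : lorentz W W = -(η * lorentz V V)) :
    lorentz (conic η V W t) (conic η V W t) = lorentz V V := by
  rw [lorentz_conic_left, lorentz_comm V, lorentz_comm W, lorentz_conic_left, lorentz_conic_left,
    lorentz_comm W V, hVW, hW]
  field_simp
  ring

lemma hasDerivAt_conic {η t : ℝ} (V W : LSpace) (ht : 1 - η * t ^ 2 ≠ 0) :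
    HasDerivAt (conic η V W) ((4 * η * t / (1 - η * t ^ 2) ^ 2) • V
      + (2 * (1 + η * t ^ 2) / (1 - η * t ^ 2) ^ 2) • W) t := by
  have h2 : HasDerivAt (fun t : ℝ => η * t ^ 2) (η * (2 * t)) t := by
    simpa using (hasDerivAt_pow 2 t).const_mul η
  have hd := h2.const_sub 1
  have hα := ((h2.const_add 1).div hd ht).smul_const V
  have hβ := (((hasDerivAt_id t).const_mul 2).div hd ht).smul_const W
  refine (hα.add hβ).congr_deriv ?_
  congr 2
  · congr 1; ring
  · congr 1; simp; ring

/-- The vectors are independent, and the first coefficient vanishes only at `t = 0`, where the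
second is `2`. -/
lemma conic_deriv_ne_zero {η t : ℝ} {V W : LSpace} (hη : η ≠ 0) (ht : 1 - η * t ^ 2 ≠ 0)
    (hVW : lorentz V W = 0) (hV : lorentz V V ≠ 0) (hW : lorentz W W ≠ 0) :
    (4 * η * t / (1 - η * t ^ 2) ^ 2) • V
      + (2 * (1 + η * t ^ 2) / (1 - η * t ^ 2) ^ 2) • W ≠ 0 := by
  intro h
  have h1 := congrArg (fun x => lorentz x V) h
  have h2 := congrArg (fun x => lorentz x W) h
  simp only [lorentz_add_left, lorentz_smul_left, lorentz_comm W V, hVW, lorentz_zero_left,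
    mul_zero, add_zero, zero_add] at h1 h2
  have h3 : t = 0 := by simpa [hV, hη, ht] using h1
  subst h3
  simp [hW] at h2

lemma contDiffOn_conic {E : Type*} [NormedAddCommGroup E] [NormedSpace ℝ E] {n : WithTop ℕ∞}
    {s : Set E} {V W : E → LSpace} {τ : E → ℝ} {η : ℝ} (hV : ContDiffOn ℝ n V s)
    (hW : ContDiffOn ℝ n W s) (hτ : ContDiffOn ℝ n τ s) (h : ∀ y ∈ s, 1 - η * τ y ^ 2 ≠ 0) :
    ContDiffOn ℝ n (fun y => conic η (V y) (W y) (τ y)) s := by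
  have h2 : ContDiffOn ℝ n (fun y => η * τ y ^ 2) s := contDiffOn_const.mul (hτ.pow 2)
  have hd : ContDiffOn ℝ n (fun y => 1 - η * τ y ^ 2) s := contDiffOn_const.sub h2
  exact (((contDiffOn_const.add h2).div hd h).smul hV).add
    (((contDiffOn_const.mul hτ).div hd h).smul hW)

/-- A nonconstant linear form takes each value at finitely many points of a conic. -/
lemma finite_conic_level {η A B : ℝ} (hη : η ≠ 0) (hAB : A ≠ 0 ∨ B ≠ 0) (m : ℝ) :
    {t : ℝ | 1 - η * t ^ 2 ≠ 0 ∧ (1 + η * t ^ 2) / (1 - η * t ^ 2) * A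
      + 2 * t / (1 - η * t ^ 2) * B = m}.Finite := by
  -- The level equation after clearing denominators. Its values at `0`, `1` and `-1` determine all
  -- its coefficients; were they all zero, then `B = 0` and `A = m = -m`.
  set P : Polynomial ℝ := Polynomial.C (A - m) + Polynomial.C (2 * B) * Polynomial.X
    + Polynomial.C (η * (A + m)) * Polynomial.X ^ 2 with hP
  have hne : P ≠ 0 := by
    intro h0
    have c0 := congrArg (Polynomial.eval 0) h0
    have c1 := congrArg (Polynomial.eval 1) h0
    have c2 := congrArg (Polynomial.eval (-1)) h0
    simp only [hP, Polynomial.eval_add, Polynomial.eval_mul, Polynomial.eval_C, Polynomial.eval_X,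
      Polynomial.eval_pow, Polynomial.eval_zero] at c0 c1 c2
    have hB : B = 0 := by linarith
    have hm : η * (A + m) = 0 := by linarith
    have hA := (mul_eq_zero.1 hm).resolve_left hη
    rcases hAB with h | h
    · exact h (by linarith)
    · exact h hB
  refine (Polynomial.finite_setOfPred_isRoot hne).subset ?_
  rintro t ⟨ht, h⟩
  simp only [Set.mem_ofPred_eq, Polynomial.IsRoot, hP, Polynomial.eval_add, Polynomial.eval_mul,
    Polynomial.eval_C, Polynomial.eval_X, Polynomial.eval_pow]
  field_simp at h
  linear_combination h

/-- A polynomial vanishing at infinitely many points of a line which is not vertical is a multiple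
of the equation of the line. -/
lemma mem_span_of_infinite {a ε : ℝ} (ha : a ≠ 0) {Q : MvPolynomial (Fin 2) ℝ}
    (h : {x : ℝ | MvPolynomial.eval ![x, (x * a ^ 2 + ε) / (2 * a)] Q = 0}.Infinite) :
    Q ∈ Ideal.span {(MvPolynomial.X 0 * MvPolynomial.C (a ^ 2)
          - MvPolynomial.C (2 * a) * MvPolynomial.X 1
          + MvPolynomial.C ε : MvPolynomial (Fin 2) ℝ)} := by
  set g : MvPolynomial (Fin 2) ℝ := MvPolynomial.X 0 * MvPolynomial.C (a ^ 2)
    - MvPolynomial.C (2 * a) * MvPolynomial.X 1 + MvPolynomial.C ε with hg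
  -- Restriction to the line, with `x` as the coordinate.
  set φ : MvPolynomial (Fin 2) ℝ →ₐ[ℝ] Polynomial ℝ := MvPolynomial.aeval
    ![Polynomial.X, Polynomial.C (2 * a)⁻¹ * (Polynomial.X * Polynomial.C (a ^ 2)
      + Polynomial.C ε)] with hφ
  have hφQ : φ Q = 0 := by
    by_contra hne
    refine h ((Polynomial.finite_setOfPred_isRoot hne).subset fun x hx => ?_)
    have : (Polynomial.aeval x).comp φ
        = MvPolynomial.aeval (R := ℝ) ![x, (x * a ^ 2 + ε) / (2 * a)] := by
      apply MvPolynomial.algHom_ext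
      intro i
      fin_cases i
      · simp [hφ]
      · simp [hφ]; ring
    have h2 := congrArg (fun f => f Q) this
    simp only [Set.mem_ofPred_eq] at hx
    change Polynomial.eval x (φ Q) = 0
    simpa only [AlgHom.comp_apply, MvPolynomial.aeval_eq_eval, RingHom.coe_coe, hx,
      Polynomial.coe_aeval_eq_eval] using h2
  rw [← Ideal.Quotient.eq_zero_iff_mem]
  let π := Ideal.Quotient.mkₐ ℝ (Ideal.span {g})
  -- The quotient map factors through `φ`, since modulo `g` the variable `y` equals its expression
  -- in `x`. So `φ Q = 0` forces `Q` into the ideal.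
  have hπ : (Polynomial.aeval (π (MvPolynomial.X 0))).comp φ = π := by
    apply MvPolynomial.algHom_ext
    intro i
    fin_cases i
    · simp [hφ]
    · have h1 : π (MvPolynomial.C (2 * a)⁻¹ * g) = 0 :=
        Ideal.Quotient.eq_zero_iff_mem.2
          (Ideal.mul_mem_left _ _ (Ideal.subset_span rfl))
      have h2 : MvPolynomial.C (2 * a)⁻¹ * g = MvPolynomial.C (2 * a)⁻¹
          * (MvPolynomial.X 0 * MvPolynomial.C (a ^ 2) + MvPolynomial.C ε)
          - MvPolynomial.X 1 := by
        have : (MvPolynomial.C (2 * a)⁻¹ * MvPolynomial.C (2 * a) : MvPolynomial (Fin 2) ℝ) = 1 := by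
          rw [← MvPolynomial.C_mul, inv_mul_cancel₀ (mul_ne_zero two_ne_zero ha), MvPolynomial.C_1]
        rw [hg]
        linear_combination (-MvPolynomial.X 1) * this
      rw [h2, map_sub, sub_eq_zero, map_mul, map_add, map_mul] at h1
      have hC : ∀ c : ℝ, π (MvPolynomial.C c) = algebraMap ℝ _ c := fun c => π.commutes c
      rw [hC, hC, hC, mul_comm (π (MvPolynomial.X 0))] at h1
      simp only [hφ, AlgHom.comp_apply, MvPolynomial.aeval_X]
      simpa [-map_inv₀, -map_pow] using h1
  have h3 := congrArg (fun f => f Q) hπ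
  simp only [AlgHom.comp_apply, hφQ, map_zero] at h3
  exact h3.symm

/-! ### Existence of local parametrizations and variation of `ξ`. -/

namespace TubularSurface

variable (S : TubularSurface)

lemma isOpen_inter_preimage_carrier {X : Type*} [TopologicalSpace X] {f : X → ℝ × LSpace}
    {W : Set X} (hW : IsOpen W) (hf : ContinuousOn f W)
    (h : ∀ y ∈ W, f y ∈ normalSections S.I S.γ S.r S.ε) : IsOpen (W ∩ f ⁻¹' S.carrier) := by
  obtain ⟨O, hO, hOc⟩ := isOpen_induced_iff.1 S.carrier_isClopen.isOpen
  have : W ∩ f ⁻¹' S.carrier = W ∩ f ⁻¹' O := by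
    ext y
    refine and_congr_right fun hy => ?_
    exact (Set.ext_iff.1 hOc ⟨f y, h y hy⟩).symm
  rw [this]
  exact hf.isOpen_inter_preimage hW hO

/-- The preimage of a clopen set in a connected space is empty or everything. This treats a full
tube and a single branch alike. -/
lemma mem_carrier_of_isPreconnected {X : Type*} [TopologicalSpace X] {f : X → ℝ × LSpace}
    {W : Set X} (hW : IsPreconnected W) (hf : ContinuousOn f W)
    (h : ∀ y ∈ W, f y ∈ normalSections S.I S.γ S.r S.ε) {y z : X} (hy : y ∈ W) (hz : z ∈ W)
    (hyc : f y ∈ S.carrier) : f z ∈ S.carrier := by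
  have : PreconnectedSpace W := Subtype.preconnectedSpace hW
  have hc : Continuous fun w : W => (⟨f w, h w w.2⟩ : normalSections S.I S.γ S.r S.ε) :=
    hf.domRestrict.subtype_mk _
  rcases isClopen_iff.1 (S.carrier_isClopen.preimage hc) with h0 | h1
  · exact absurd (h0 ▸ hyc : (⟨y, hy⟩ : W) ∈ (∅ : Set W)) (Set.notMem_empty _)
  · have : (⟨z, hz⟩ : W) ∈ (Set.univ : Set W) := trivial
    rw [← h1] at this
    exact this

/-- The points where the normal planes can be identified with that of `a` by a reflection. -/
def reflectionDomain (a : LSpace) : Set ℝ :=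
  {s ∈ S.I | lorentz (deriv S.γ s + a) (deriv S.γ s + a) ≠ 0}

lemma isOpen_reflectionDomain (a : LSpace) : IsOpen (S.reflectionDomain a) := by
  have hc := S.contDiffOn_deriv.add (contDiffOn_const (c := a))
  exact (contDiffOn_lorentz hc hc).continuousOn.isOpen_inter_preimage S.isOpen_I
    isOpen_compl_singleton

/-- This is why the mirror vector is the sum of the tangents: at `s` it is `2 γ'`, which is not
isotropic, whereas the difference would vanish. -/
lemma mem_reflectionDomain {s : ℝ} (hs : s ∈ S.I) : s ∈ S.reflectionDomain (deriv S.γ s) := by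
  refine ⟨hs, ?_⟩
  have : deriv S.γ s + deriv S.γ s = (2 : ℝ) • deriv S.γ s := by module
  rw [this, lorentz_smul_left, lorentz_smul_right]
  intro h0
  have h1 := S.tangent_sq hs
  have h2 : lorentz (deriv S.γ s) (deriv S.γ s) = 0 := by linarith
  rw [h2] at h1
  norm_num at h1

lemma contDiffOn_reflection (a x : LSpace) : ContDiffOn ℝ ∞
    (fun s => lorentzReflection (deriv S.γ s + a) x) (S.reflectionDomain a) :=
  contDiffOn_lorentzReflection
    ((S.contDiffOn_deriv.mono fun _ h => h.1).add contDiffOn_const) (fun _ h => h.2) x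

lemma lorentz_reflection_tangent {s s' : ℝ} (hs' : s' ∈ S.I) {x : LSpace}
    (hs : s ∈ S.reflectionDomain (deriv S.γ s')) (hx : lorentz x (deriv S.γ s') = 0) :
    lorentz (lorentzReflection (deriv S.γ s + deriv S.γ s') x) (deriv S.γ s) = 0 :=
  lorentz_reflection_add_eq_zero hs.2 (S.tangent_const hs.1 hs') hx

lemma lorentz_reflection_tangent_symm {s s' : ℝ} (hs' : s' ∈ S.I) {x : LSpace}
    (hs : s ∈ S.reflectionDomain (deriv S.γ s')) (hx : lorentz x (deriv S.γ s) = 0) :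
    lorentz (lorentzReflection (deriv S.γ s + deriv S.γ s') x) (deriv S.γ s') = 0 := by
  have h := hs.2
  rw [add_comm] at h ⊢
  exact lorentz_reflection_add_eq_zero h (S.tangent_const hs' hs.1) hx

/-- The surface meets every normal plane of the central curve. -/
lemma exists_mem_carrier {s : ℝ} (hs : s ∈ S.I) : ∃ v, (s, v) ∈ S.carrier := by
  obtain ⟨⟨s₀, v₀⟩, h₀⟩ := S.carrier_nonempty
  refine S.ordConnected_I.isPreconnected.induction₂'
    (fun x y => (∃ v, (x, v) ∈ S.carrier) → ∃ v, (y, v) ∈ S.carrier) ?_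
    (fun x y z _ _ _ h1 h2 h => h2 (h1 h)) (S.carrier_subset h₀).1 hs ⟨v₀, h₀⟩
  intro x hx
  obtain ⟨δ, hδ, hball⟩ := Metric.isOpen_iff.1 (S.isOpen_reflectionDomain (deriv S.γ x)) x
    (S.mem_reflectionDomain hx)
  have key : ∀ y ∈ Metric.ball x δ, ∀ z ∈ Metric.ball x δ,
      (∃ v, (y, v) ∈ S.carrier) → ∃ v, (z, v) ∈ S.carrier := by
    rintro y hy z hz ⟨v, hv⟩
    set w := lorentzReflection (deriv S.γ y + deriv S.γ x) v with hw
    have hvs := S.carrier_subset hv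
    have hwx : lorentz w (deriv S.γ x) = 0 :=
      S.lorentz_reflection_tangent_symm hx (hball hy) hvs.2.1
    have hww : lorentz w w = S.ε * S.r ^ 2 := by
      rw [hw, lorentz_reflection_reflection (hball hy).2]; exact hvs.2.2
    -- Reflecting the fixed vector `w`, normal at `x`, into each normal plane gives a continuous
    -- family which at `y` returns to `v`.
    refine ⟨lorentzReflection (deriv S.γ z + deriv S.γ x) w,
      S.mem_carrier_of_isPreconnected
        (f := fun t => (t, lorentzReflection (deriv S.γ t + deriv S.γ x) w))
        (convex_ball x δ).isPreconnected
        (continuousOn_id.prodMk ((S.contDiffOn_reflection _ w).continuousOn.mono hball))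
        (fun t ht => ⟨(hball ht).1, S.lorentz_reflection_tangent hx (hball ht) hwx, ?_⟩)
        hy hz ?_⟩
    · rw [← hww]; exact lorentz_reflection_reflection (hball ht).2 _ _
    · simp only [hw]
      rwa [lorentzReflection_involutive (hball hy).2]
  refine mem_nhdsWithin_of_mem_nhds (Filter.mem_of_superset (Metric.ball_mem_nhds x hδ) ?_)
  intro y hy
  exact ⟨key x (Metric.mem_ball_self hδ) y hy, key y hy x (Metric.mem_ball_self hδ)⟩

/-- Through every point of a regular tubular surface there is a local parametrization in which the
normal section is the rational conic. -/
theorem exists_isLocalParam (hS : S.IsRegular) {s₀ : ℝ} {v₀ : LSpace}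
    (h₀ : (s₀, v₀) ∈ S.carrier) : ∃ (U : Set (ℝ × ℝ)) (v : ℝ × ℝ → LSpace),
      S.IsLocalParam U Prod.fst v ∧ (s₀, 0) ∈ U ∧ ∀ t, (s₀, t) ∈ U →
        1 - lorentz (deriv S.γ s₀) (deriv S.γ s₀) * t ^ 2 ≠ 0 ∧
        v (s₀, t) = conic (lorentz (deriv S.γ s₀) (deriv S.γ s₀)) v₀
          (lorentzCross (deriv S.γ s₀) v₀) t := by
  obtain ⟨hI, hvT, hvv⟩ := S.carrier_subset h₀
  dsimp only at hI hvT hvv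
  set a := deriv S.γ s₀ with ha
  set η := lorentz a a with hη
  set u := lorentzCross a v₀ with hu
  have hη2 : η ^ 2 = 1 := S.tangent_sq hI
  have hη0 : η ≠ 0 := fun h0 => by rw [h0] at hη2; norm_num at hη2
  have hvn : lorentz v₀ v₀ ≠ 0 := by
    rw [hvv]; exact mul_ne_zero S.signal_ne_zero (pow_ne_zero 2 S.r_pos.ne')
  have hvu : lorentz v₀ u = 0 := by rw [lorentz_comm]; exact lorentz_cross_right _ _
  have huT : lorentz u a = 0 := lorentz_cross_left _ _
  have huu : lorentz u u = -(η * lorentz v₀ v₀) := by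
    rw [hu, lorentz_cross_self, lorentz_comm a v₀, hvT]; ring
  have hun : lorentz u u ≠ 0 := by rw [huu]; exact neg_ne_zero.2 (mul_ne_zero hη0 hvn)
  set V : ℝ → LSpace → LSpace := fun s x => lorentzReflection (deriv S.γ s + a) x with hV
  have hVi : ∀ s ∈ S.reflectionDomain a, ∀ x y, lorentz (V s x) (V s y) = lorentz x y :=
    fun s hs x y => lorentz_reflection_reflection hs.2 x y
  -- At `s₀` the mirror is the normal plane itself, hence fixed pointwise.
  have hV₀ : ∀ x, lorentz x a = 0 → V s₀ x = x := by
    intro x hx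
    simp [hV, lorentzReflection, lorentz_add_right, ← ha, hx]
  set v : ℝ × ℝ → LSpace := fun q => conic η (V q.1 v₀) (V q.1 u) q.2 with hv
  set W : Set (ℝ × ℝ) := {q | q.1 ∈ S.reflectionDomain a ∧ 1 - η * q.2 ^ 2 ≠ 0} with hW
  have hWo : IsOpen W := ((S.isOpen_reflectionDomain a).preimage continuous_fst).inter
    (isOpen_compl_singleton.preimage (by fun_prop : Continuous fun q : ℝ × ℝ => 1 - η * q.2 ^ 2))
  have hVs : ∀ x, ContDiffOn ℝ ∞ (fun q : ℝ × ℝ => V q.1 x) W := fun x =>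
    (S.contDiffOn_reflection a x).comp contDiffOn_fst fun q hq => hq.1
  have hvs : ContDiffOn ℝ ∞ v W :=
    contDiffOn_conic (hVs v₀) (hVs u) contDiffOn_snd fun q hq => hq.2
  have hsec : ∀ q ∈ W, (q.1, v q) ∈ normalSections S.I S.γ S.r S.ε := by
    intro q hq
    refine ⟨hq.1.1, ?_, ?_⟩
    · simp only [hv, lorentz_conic_left]
      rw [S.lorentz_reflection_tangent hI hq.1 hvT, S.lorentz_reflection_tangent hI hq.1 huT]
      ring
    · have hq1 := hVi q.1 hq.1
      simp only [hv]
      rw [lorentz_conic_self hq.2 (by rw [hq1, hvu]) (by rw [hq1, hq1, huu]), hq1, hvv]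
  set U : Set (ℝ × ℝ) := W ∩ (fun q => (q.1, v q)) ⁻¹' S.carrier with hU
  have hUo : IsOpen U := S.isOpen_inter_preimage_carrier hWo
    (continuousOn_fst.prodMk hvs.continuousOn) hsec
  have hv₀ : ∀ t, v (s₀, t) = conic η v₀ u t := by
    intro t
    simp only [hv, hV₀ v₀ hvT, hV₀ u huT]
  refine ⟨U, v, ⟨hUo, contDiffOn_fst, hvs.mono Set.inter_subset_left, fun q hq => hq.2, ?_⟩,
    ⟨⟨S.mem_reflectionDomain hI, by simp⟩, ?_⟩, fun t ht => ⟨ht.1.2, hv₀ t⟩⟩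
  -- The `T`-component of a kernel vector `(x, y)` is `η ξ x`, so regularity gives `x = 0`; what
  -- remains is `y` times the nonzero velocity of the conic.
  · intro q hq
    have hdv : DifferentiableAt ℝ v q :=
      (hvs.contDiffAt (hWo.mem_nhds hq.1)).differentiableAt (by simp)
    rw [injective_iff_map_eq_zero]
    rintro ⟨x, y⟩ h
    have h1 := S.lorentz_tangent_fderiv_tube hq.1.1.1 differentiableAt_fst hdv
      (Filter.eventually_of_mem (hWo.mem_nhds hq.1) fun z hz => (hsec z hz).2.1) (x, y)
    rw [h, lorentz_comm, lorentz_zero_left, fderiv_fst] at h1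
    have hx : x = 0 := by
      have hT : lorentz (deriv S.γ q.1) (deriv S.γ q.1) ≠ 0 := by
        rw [S.tangent_const hq.1.1.1 hI]; exact hη0
      simpa [hT, hS _ hq.2] using h1.symm
    subst hx
    rw [S.fderiv_tube hq.1.1.1 differentiableAt_fst hdv, fderiv_fst] at h
    have hd : HasDerivAt (fun t => v (q.1, t)) (fderiv ℝ v q (0, 1)) q.2 :=
      HasFDerivAt.comp_hasDerivAt (f := fun t => (q.1, t)) q.2 hdv.hasFDerivAt
        ((hasDerivAt_const _ _).prodMk (hasDerivAt_id _))
    have hq1 := hVi q.1 hq.1.1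
    have hne := conic_deriv_ne_zero (V := V q.1 v₀) (W := V q.1 u) hη0 hq.1.2
      (by rw [hq1, hvu]) (by rwa [hq1]) (by rwa [hq1])
    have he : ((0 : ℝ), y) = y • ((0 : ℝ), (1 : ℝ)) := by simp
    rw [he, map_smul, map_smul, hd.unique (hasDerivAt_conic (V q.1 v₀) (V q.1 u) hq.1.2)] at h
    have hy : y = 0 := by
      rw [ContinuousLinearMap.coe_fst', smul_zero, zero_smul, zero_add] at h
      exact (smul_eq_zero.1 h).resolve_right hne
    rw [hy]; rfl
  · change (s₀, v (s₀, 0)) ∈ S.carrier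
    rwa [hv₀, conic_zero]

lemma lorentz_tangent_deriv {s : ℝ} (hs : s ∈ S.I) :
    lorentz (deriv S.γ s) (deriv (deriv S.γ) s) = 0 := by
  have hd := S.differentiableAt_tangent hs
  have h := lorentz_fderiv_add_of_eventually_const hd hd
    (Filter.eventually_of_mem (S.isOpen_I.mem_nhds hs) fun t ht => S.tangent_const ht hs) 1
  rw [lorentz_comm _ (deriv S.γ s)] at h
  simp only [fderiv_apply_one_eq_deriv] at h
  linarith

/-- The Gaussian curvature takes infinitely many values on a normal section at a point where the
central curve is not straight. -/
lemma infinite_gaussCurvature (hS : S.IsRegular) {s : ℝ} (hs : s ∈ S.I)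
    (hk : deriv (deriv S.γ) s ≠ 0) : ∃ (U : Set (ℝ × ℝ)) (v : ℝ × ℝ → LSpace),
      S.IsLocalParam U Prod.fst v ∧
      ((fun q => S.ε * (1 - (S.xi (q.1, v q))⁻¹) / S.r ^ 2) '' U).Infinite := by
  obtain ⟨v₀, h₀⟩ := S.exists_mem_carrier hs
  obtain ⟨U, v, hU, hmem, hv⟩ := S.exists_isLocalParam hS h₀
  refine ⟨U, v, hU, ?_⟩
  obtain ⟨-, hvT, hvv⟩ := S.carrier_subset h₀
  dsimp only at hvT hvv
  set k := deriv (deriv S.γ) s with hkdef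
  set a := deriv S.γ s with ha
  set η := lorentz a a with hη
  have hη2 : η ^ 2 = 1 := S.tangent_sq hs
  have hη0 : η ≠ 0 := fun h0 => by rw [h0] at hη2; norm_num at hη2
  have hvn : lorentz v₀ v₀ ≠ 0 := by
    rw [hvv]; exact mul_ne_zero S.signal_ne_zero (pow_ne_zero 2 S.r_pos.ne')
  have hAB : lorentz v₀ k ≠ 0 ∨ lorentz (lorentzCross a v₀) k ≠ 0 := by
    by_contra! h
    exact hk (eq_zero_of_orthogonal_cross hη0 hvn (by rw [lorentz_comm]; exact hvT)
      (S.lorentz_tangent_deriv hs) h.1 h.2)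
  set N : Set ℝ := (fun t => (s, t)) ⁻¹' U with hN
  have hNo : IsOpen N := hU.isOpen.preimage (by fun_prop)
  have hNi : N.Infinite := infinite_of_mem_nhds 0 (hNo.mem_nhds hmem)
  set f : ℝ × ℝ → ℝ := fun q => S.ε * (1 - (S.xi (q.1, v q))⁻¹) / S.r ^ 2 with hf
  -- An infinite set whose image has finite fibres has an infinite image: equal values of `f` mean
  -- equal `ξ`, hence equal `⟨v, γ''⟩`, which is a level set on the conic.
  have key : ((fun t => f (s, t)) '' N).Infinite := by
    intro hfin
    refine hNi (Set.Finite.of_finite_fibers _ hfin ?_)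
    rintro _ ⟨t₀, ht₀, rfl⟩
    refine (finite_conic_level hη0 hAB (lorentz (v (s, t₀)) k)).subset ?_
    rintro t ⟨ht, he⟩
    have hε := S.signal_ne_zero
    have hr := S.r_pos.ne'
    have hx : S.xi (s, v (s, t)) = S.xi (s, v (s, t₀)) := by
      simpa [hf, hε, hr] using he
    refine ⟨(hv t ht).1, ?_⟩
    rw [← lorentz_conic_left, ← (hv t ht).2]
    simpa [xi, ← ha, ← hη, ← hkdef, hη0] using hx
  refine key.mono ?_
  rintro _ ⟨t, ht, rfl⟩
  exact ⟨(s, t), ht, rfl⟩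

end TubularSurface

/-! ### The polynomial relations. -/

theorem mainTheorem6 (S : TubularSurface) (hS : S.IsRegular) :
    (S.IsRightCylinder →
      S.polynomialRelations = {Q | S.r ∈ lorentzRadius S.ε Q}) ∧
    (¬ S.IsRightCylinder →
      S.polynomialRelations =
        (Ideal.span {(MvPolynomial.X 0 * MvPolynomial.C (S.r ^ 2)
          - MvPolynomial.C (2 * S.r) * MvPolynomial.X 1
          + MvPolynomial.C S.ε : MvPolynomial (Fin 2) ℝ)} :
            Set (MvPolynomial (Fin 2) ℝ))) := by
  have hr := S.r_pos.ne'
  constructor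
  · intro hC
    have hK : ∀ U σ v, S.IsLocalParam U σ v → ∀ q ∈ U,
        gaussCurvature (fun q => S.γ (σ q) + v q) (fun q => -(S.r⁻¹ • v q)) q = 0 ∧
        meanCurvature (fun q => S.γ (σ q) + v q) (fun q => -(S.r⁻¹ • v q)) q
          = S.ε / (2 * S.r) := by
      intro U σ v h q hq
      have hx : S.xi (σ q, v q) = 1 := by
        simp only [TubularSurface.xi, hC _ (S.carrier_subset (h.mem q hq)).1]
        rw [lorentz_comm (v q), lorentz_zero_left]; ring
      obtain ⟨h1, h2⟩ := S.curvatures hS h hq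
      rw [h1, h2, hx]
      norm_num
    ext Q
    constructor
    · intro hQ
      obtain ⟨⟨s₀, v₀⟩, h₀⟩ := S.carrier_nonempty
      obtain ⟨U, v, hU, hmem, -⟩ := S.exists_isLocalParam hS h₀
      have h := hQ U _ v hU _ hmem
      rw [(hK U _ v hU _ hmem).1, (hK U _ v hU _ hmem).2] at h
      exact ⟨S.r_pos, h⟩
    · intro hQ U σ v h q hq
      rw [(hK U σ v h q hq).1, (hK U σ v h q hq).2]
      exact hQ.2
  · intro hC
    ext Q
    constructor
    · intro hQ
      simp only [TubularSurface.IsRightCylinder, not_forall] at hC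
      obtain ⟨s, hs, hk⟩ := hC
      obtain ⟨U, v, hU, hinf⟩ := S.infinite_gaussCurvature hS hs hk
      refine mem_span_of_infinite hr (hinf.mono ?_)
      rintro _ ⟨q, hq, rfl⟩
      have h := hQ U _ v hU q hq
      rw [(S.curvatures hS hU hq).1, (S.curvatures hS hU hq).2] at h
      -- With `y = ξ⁻¹`, the mean curvature is the ordinate of the point of the line with abscissa
      -- `K`.
      have hH : ∀ y : ℝ, (S.ε * (1 - y) / S.r ^ 2 * S.r ^ 2 + S.ε) / (2 * S.r)
          = S.ε * (2 - y) / (2 * S.r) := by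
        intro y; field_simp; ring
      simp only [Set.mem_ofPred_eq, hH]
      exact h
    · intro hQ U σ v h q hq
      obtain ⟨P, rfl⟩ := Ideal.mem_span_singleton'.1 hQ
      obtain ⟨h1, h2⟩ := S.curvatures hS h hq
      rw [h1, h2]
      simp
      right
      field_simp
      ring
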